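/- Let $\rho:\mathfrak g\to\mathrm{gl}(V)$ be a finite-dimensional representation of a finite-dimensional complex Lie algebra. For $x\in V$ let $R_x:\mathfrak g\to V$, $R_x(\xi)=\rho(\xi)x$. Put $\dim\mathcal O_{\mathrm{reg}}=\max_{x\in V}\operatorname{rk}R_x$ and $q=\operatorname{codim}\mathcal O_{\mathrm{reg}}=\dim V-\dim\mathcal O_{\mathrm{reg}}$. A polynomial $f$ on $V$ is an invariant of $\rho$ if $R_x^*(df(x))=0$ for all $x\in V$. By the theorem on the canonical form of a pair of linear maps, for all $x,a\in V$ there are bases of $\mathfrak g$ and $V$ in which $R_x$ and $R_a$ are simultaneously block-diagonal, each diagonal block of the pencil $R_x+\lambda R_a$ being a Jordan block (with finite or infinite eigenvalue), a horizontal Kronecker block of size $\varepsilon\times(\varepsilon+1)$, $\varepsilon\ge 0$, or a vertical Kronecker block of size $(\eta+1)\times\eta$, $\eta\ge0$ (a zero $g\times h$ block being regarded as $g$ vertical blocks of size $1\times0$ and $h$ horizontal blocks of size $0\times1$). The algebraic type of the pencil consists of the numbers $\eta$ of columns of the vertical blocks (the minimal row indices), the numbers $\varepsilon$ of rows of the horizontal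 blocks (the minimal column indices), the number of distinct eigenvalues, and the sizes of the Jordan blocks for each eigenvalue. This type is the same for all pairs $(x,a)$ in some non-empty Zariski open subset of $V\times V$. The minimal row indices $\eta_1(\rho),\eta_2(\rho),\dots$ of $\rho$ are those of this generic type, and $\mathsf k_{\mathrm{vert}}(\rho)=\sum_j(\eta_j(\rho)+1)$. Suppose that $f_1,\dots,f_q$ are algebraically independent invariant polynomials of $\rho$ such that $$\sum_{\alpha=1}^q\deg f_\alpha=\mathsf k_{\mathrm{vert}}(\rho).$$ Then the minimal row indices of $\rho$ are exactly the numbers $\deg f_\alpha-1$: every $\deg f_\alpha$ is at least $1$, there are exactly $q$ minimal row indices, and, with multiplicities and when both sequences are arranged in non-decreasing order, $$\eta_\alpha(\rho)=\deg f_\alpha-1,\qquad \alpha=1,\dots,q.$$ -/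

import Mathlib

-- The Lie bracket of `End V` is the commutator.
attribute [local instance 100] LieRing.ofAssociativeRing

/-- A block of the Jordan-Kronecker canonical form of a pencil `A + t B`. -/
inductive KroneckerBlock : Type
  /-- The Jordan block of size `n + 1` with a finite eigenvalue `c`. -/
  | jordan (c : ℂ) (n : ℕ)
  /-- The Jordan block of size `n + 1` with eigenvalue `∞`. -/
  | jordanInf (n : ℕ)
  /-- The horizontal Kronecker block with `e` rows and `e + 1` columns. -/
  | horizontal (e : ℕ)
  /-- The vertical Kronecker block with `n + 1` rows and `n` columns. -/
  | vertical (n : ℕ)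

namespace KroneckerBlock

/-- Number of rows of a block. -/
def rows : KroneckerBlock → ℕ
  | jordan _ n => n + 1
  | jordanInf n => n + 1
  | horizontal e => e
  | vertical n => n + 1

/-- Number of columns of a block. -/
def cols : KroneckerBlock → ℕ
  | jordan _ n => n + 1
  | jordanInf n => n + 1
  | horizontal e => e + 1
  | vertical n => n

/-- The `(i, j)` entry of the matrix `A` of a block. -/
def entryA : KroneckerBlock → ℕ → ℕ → ℂ
  | jordan c _, i, j => if i = j then c else if j = i + 1 then 1 else 0
  | jordanInf _, i, j => if i = j then 1 else 0
  | horizontal _, i, j => if i = j then 1 else 0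
  | vertical _, i, j => if i = j then 1 else 0

/-- The `(i, j)` entry of the matrix `B` of a block. -/
def entryB : KroneckerBlock → ℕ → ℕ → ℂ
  | jordan _ _, i, j => if i = j then 1 else 0
  | jordanInf _, i, j => if j = i + 1 then 1 else 0
  | horizontal _, i, j => if j = i + 1 then 1 else 0
  | vertical _, i, j => if i = j + 1 then 1 else 0

/-- The matrix `A` of a block. -/
def matA (b : KroneckerBlock) : Matrix (Fin b.rows) (Fin b.cols) ℂ :=
  Matrix.of fun i j => b.entryA i j

/-- The matrix `B` of a block. -/
def matB (b : KroneckerBlock) : Matrix (Fin b.rows) (Fin b.cols) ℂ :=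
  Matrix.of fun i j => b.entryB i j

/-- The minimal row index (number of columns) of a vertical block. -/
def rowIndex? : KroneckerBlock → Option ℕ
  | vertical n => some n
  | _ => none

/-- The minimal column index (number of rows) of a horizontal block. -/
def colIndex? : KroneckerBlock → Option ℕ
  | horizontal e => some e
  | _ => none

/-- Eigenvalue and size of a Jordan block. -/
def jordanData? : KroneckerBlock → Option (OnePoint ℂ × ℕ)
  | jordan c n => some (↑c, n + 1)
  | jordanInf n => some (OnePoint.infty, n + 1)
  | _ => none

end KroneckerBlock

/-- The algebraic type of a pencil: the minimal row indices, the minimal column indices, and the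
sizes of the Jordan blocks grouped by eigenvalue (one multiset of sizes for each distinct
eigenvalue; the eigenvalues themselves are forgotten). -/
@[ext]
structure PencilType : Type where
  rowIndices : Multiset ℕ
  colIndices : Multiset ℕ
  jordanSizes : Multiset (Multiset ℕ)

/-- The total Kronecker `v`-index: the total number of rows in the vertical blocks. -/
def PencilType.kVert (t : PencilType) : ℕ := (t.rowIndices.map (· + 1)).sum

open scoped Classical in
/-- The algebraic type read off from the multiset of blocks of a canonical form. -/
noncomputable def PencilType.ofBlocks (s : Multiset KroneckerBlock) : PencilType where
  rowIndices := s.filterMap KroneckerBlock.rowIndex?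
  colIndices := s.filterMap KroneckerBlock.colIndex?
  jordanSizes :=
    let J := s.filterMap KroneckerBlock.jordanData?
    (J.map Prod.fst).toFinset.val.map fun c => (J.filter fun d => d.1 = c).map Prod.snd

section Pencil

variable {U V : Type*} [AddCommGroup U] [Module ℂ U] [AddCommGroup V] [Module ℂ V]

/-- The pencil `A + t B` has algebraic type `t`: in suitable bases of `U` and `V` the matrices of
`A` and `B` are simultaneously block-diagonal with Jordan and Kronecker blocks, and `t` is the type
read off from these blocks. A zero `g × h` block is regarded as `g` vertical blocks of size `1 × 0`
and `h` horizontal blocks of size `0 × 1`. -/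
def HasPencilType (A B : U →ₗ[ℂ] V) (t : PencilType) : Prop :=
  ∃ (N : ℕ) (β : Fin N → KroneckerBlock)
    (bU : Module.Basis (Σ k, Fin (β k).cols) ℂ U) (bV : Module.Basis (Σ k, Fin (β k).rows) ℂ V),
    LinearMap.toMatrix bU bV A = Matrix.blockDiagonal' (fun k => (β k).matA) ∧
    LinearMap.toMatrix bU bV B = Matrix.blockDiagonal' (fun k => (β k).matB) ∧
    PencilType.ofBlocks (Finset.univ.val.map β) = t

end Pencil

/-- Zariski open subsets of a complex vector space `W`. Polynomial functions on `W` are the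
polynomials in linear functionals on `W`. -/
def IsZariskiOpen {W : Type*} [AddCommGroup W] [Module ℂ W] (O : Set W) : Prop :=
  ∃ S : Set (MvPolynomial (Module.Dual ℂ W) ℂ),
    O = {w | ∃ p ∈ S, MvPolynomial.eval (fun φ : Module.Dual ℂ W => φ w) p ≠ 0}

section Representation

variable {𝔤 V : Type*} [LieRing 𝔤] [LieAlgebra ℂ 𝔤] [AddCommGroup V] [Module ℂ V]

/-- The operator `R_x : 𝔤 → V`, `R_x ξ = ρ(ξ) x`. -/
def orbitMap (ρ : 𝔤 →ₗ⁅ℂ⁆ Module.End ℂ V) (x : V) : 𝔤 →ₗ[ℂ] V where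
  toFun ξ := ρ ξ x
  map_add' ξ ζ := by simp
  map_smul' c ξ := by simp

/-- The dimension of a regular orbit, `max_x rk R_x`. -/
noncomputable def dimRegularOrbit (ρ : 𝔤 →ₗ⁅ℂ⁆ Module.End ℂ V) : ℕ :=
  ⨆ x : V, Module.finrank ℂ (LinearMap.range (orbitMap ρ x))

/-- The codimension of a regular orbit. -/
noncomputable def codimRegularOrbit (ρ : 𝔤 →ₗ⁅ℂ⁆ Module.End ℂ V) : ℕ :=
  Module.finrank ℂ V - dimRegularOrbit ρ

/-- `t` is the type of the pencil `R_x + t R_a` for generic `(x, a)`, i.e. for all pairs in some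
non-empty Zariski open subset of `V × V`. -/
def IsGenericType (ρ : 𝔤 →ₗ⁅ℂ⁆ Module.End ℂ V) (t : PencilType) : Prop :=
  ∃ O : Set (V × V), IsZariskiOpen O ∧ O.Nonempty ∧
    ∀ p ∈ O, HasPencilType (orbitMap ρ p.1) (orbitMap ρ p.2) t

open scoped Classical in
/-- The Jordan-Kronecker invariant of `ρ`: the algebraic type of a generic pencil `R_x + t R_a`.
(For finite-dimensional `𝔤` and `V` it exists and is unique, by the theorem on the canonical form
of a pencil; the default value is never used.) -/
noncomputable def jordanKroneckerInvariant (ρ : 𝔤 →ₗ⁅ℂ⁆ Module.End ℂ V) : PencilType :=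
  if h : ∃ t, IsGenericType ρ t then h.choose else ⟨0, 0, 0⟩

/-- The minimal row indices `η_1(ρ), …, η_q(ρ)` of `ρ`, with multiplicities. -/
noncomputable def minimalRowIndices (ρ : 𝔤 →ₗ⁅ℂ⁆ Module.End ℂ V) : Multiset ℕ :=
  (jordanKroneckerInvariant ρ).rowIndices

/-- The total Kronecker `v`-index of `ρ`. -/
noncomputable def totalKroneckerVIndex (ρ : 𝔤 →ₗ⁅ℂ⁆ Module.End ℂ V) : ℕ :=
  (jordanKroneckerInvariant ρ).kVert

variable {ι : Type*} [Fintype ι]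

/-- The differential `df(x) ∈ V*` of the polynomial function on `V` that is given by `f` in the
linear coordinates of the basis `b`. -/
noncomputable def differentialAt (b : Module.Basis ι ℂ V) (f : MvPolynomial ι ℂ) (x : V) :
    Module.Dual ℂ V :=
  ∑ i, MvPolynomial.eval (fun j => b.repr x j) (MvPolynomial.pderiv i f) • b.coord i

/-- `f` is an invariant polynomial of `ρ`: `R_x^* (df(x)) = 0` for all `x`. -/
def IsInvariantPolynomial (ρ : 𝔤 →ₗ⁅ℂ⁆ Module.End ℂ V) (b : Module.Basis ι ℂ V)
    (f : MvPolynomial ι ℂ) : Prop :=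
  ∀ x : V, (orbitMap ρ x).dualMap (differentialAt b f x) = 0

end Representation

/-! For generic `(x, a)` the curve `s ↦ df_α(x + s a)` in `V*` is polynomial of degree at most `deg
f_α - 1`, and invariance puts it in the left kernel of `R_x + s R_a`. By the Jacobian criterion
(`AlgebraicIndependent.exists_linearIndependent_pderiv`) the `q` curves are linearly independent at
`s = 0` for generic `x`. In canonical form only vertical blocks carry left kernel: one line over
`ℂ(X)` each, with every nonzero polynomial solution of degree at least `η`. Independence gives at
least `q` vertical blocks, the rank of `R_x` at most `q`. A nonzero term of a `q × q` determinant
matches curves with blocks so that `η ≤ deg f_α - 1` for each pair; equality of the sums then forces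
equality in every pair. This is `HasPencilType.rowIndices_eq`, applied at a point supplied by
`IsZariskiOpen.exists_regular_mem`. -/

/-! ### The Jacobian criterion in characteristic zero. -/

/-- A derivation that kills a subalgebra kills every element algebraic over it. -/
theorem Derivation.eq_zero_of_isAlgebraic {k A : Type*} [Field k] [CharZero k] [CommRing A]
    [IsDomain A] [Algebra k A] (D : Derivation k A A) (L : Subalgebra k A)
    (hD : ∀ y ∈ L, D y = 0) {a : A} (ha : IsAlgebraic L a) : D a = 0 := by
  classical
  have key : ∀ P : Polynomial L, D (Polynomial.aeval a P)
      = Polynomial.aeval a (Polynomial.derivative P) * D a := by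
    intro P
    induction P using Polynomial.induction_on' with
    | add p q hp hq => simp [hp, hq, add_mul]
    | monomial n c =>
      rw [Polynomial.aeval_monomial, Polynomial.derivative_monomial, Polynomial.aeval_monomial,
        Derivation.leibniz, Derivation.leibniz_pow, hD _ (show algebraMap L A c ∈ L from c.2)]
      simp [nsmul_eq_mul]
      ring
  have hchar : CharZero L := charZero_of_injective_algebraMap (algebraMap k L).injective
  -- Descent on the degree: if `P'(a) = 0`, then `P'` is a nonzero annihilator of smaller degree.
  suffices h : ∀ n, ∀ P : Polynomial L, P.natDegree = n → P ≠ 0 → Polynomial.aeval a P = 0 →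
      D a = 0 by
    obtain ⟨P, hP, h0⟩ := ha
    exact h _ P rfl hP h0
  intro n
  induction n using Nat.strong_induction_on with
  | _ n ih =>
    intro P hn hP h0
    have h1 := key P
    rw [h0, map_zero, eq_comm, mul_eq_zero] at h1
    rcases h1 with h1 | h1
    · have hpos : P.natDegree ≠ 0 := by
        intro h
        rw [Polynomial.natDegree_eq_zero] at h
        obtain ⟨c, rfl⟩ := h
        simp at h0 hP
        exact hP h0
      refine ih _ ?_ _ rfl ?_ h1
      · rw [← hn]
        exact Polynomial.natDegree_derivative_lt hpos
      · intro h
        exact hpos (Polynomial.derivative_eq_zero.1 h)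
    · exact h1

open MvPolynomial in
/-- Jacobian criterion: the differentials of algebraically independent polynomials are linearly
independent at some point. -/
theorem AlgebraicIndependent.exists_linearIndependent_pderiv {k ι κ : Type*} [Field k] [CharZero k]
    [Fintype ι] {f : κ → MvPolynomial ι k} (hf : AlgebraicIndependent k f) :
    ∃ x : ι → k, LinearIndependent k (fun α i => eval x (pderiv i (f α))) := by
  classical
  -- Completing to a transcendence basis makes the Jacobian matrix square.
  obtain ⟨s, hs, hbs⟩ := exists_isTranscendenceBasis_superset hf.to_subtype_range
  obtain ⟨e⟩ : Nonempty (ι ≃ s) := by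
    have := (IsTranscendenceBasis.mvPolynomial ι k).lift_cardinalMk_eq hbs
    exact Cardinal.lift_mk_eq'.1 this
  let J : Matrix ι ι (MvPolynomial ι k) := Matrix.of fun j i => pderiv i (e j : MvPolynomial ι k)
  have hJ : J.det ≠ 0 := by
    intro h0
    obtain ⟨c, hc, hJc⟩ := Matrix.exists_mulVec_eq_zero_iff.2 h0
    apply hc
    -- A kernel vector `c` of the Jacobian is a derivation `∑ c i ∂ᵢ` that kills `s`, hence all of
    -- the polynomial ring, which is algebraic over `s`; so `c i = D (X i) = 0`.
    let D := mkDerivation k c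
    have hDe : ∀ p, D p = ∑ i, pderiv i p * c i := by
      intro p
      have hsum : ∀ p, (∑ i, c i • pderiv i : Derivation k (MvPolynomial ι k) _) p
          = ∑ i, pderiv i p * c i := by
        intro p
        rw [← Derivation.coeFnAddMonoidHom_apply, map_sum, Finset.sum_apply]
        exact Finset.sum_congr rfl fun i _ => mul_comm _ _
      have : D = ∑ i, c i • pderiv i := by
        apply MvPolynomial.derivation_ext
        intro j
        rw [hsum]
        simp [D, pderiv_X, Pi.single_apply, mkDerivation_X]
      rw [this, hsum]
    have hDs : ∀ y ∈ Algebra.adjoin k s, D y = 0 := by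
      intro y hy
      have := Derivation.eqOn_adjoin (D1 := D) (D2 := 0) (s := s) (by
        intro p hp
        have := congrFun hJc (e.symm ⟨p, hp⟩)
        simpa [hDe, Matrix.mulVec, dotProduct, J] using this)
      simpa using this hy
    have halg := hbs.isAlgebraic
    rw [Subtype.range_coe] at halg
    funext i
    have := D.eq_zero_of_isAlgebraic _ hDs (halg.isAlgebraic (X i))
    simpa [D, mkDerivation_X] using this
  obtain ⟨x, hx⟩ : ∃ x, eval x J.det ≠ 0 := by
    by_contra! h
    exact hJ (MvPolynomial.funext (by simpa using h))
  refine ⟨x, ?_⟩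
  rw [RingHom.map_det] at hx
  have hrow := Matrix.linearIndependent_rows_of_det_ne_zero hx
  let τ : κ → ι := fun α => e.symm ⟨f α, hs ⟨α, rfl⟩⟩
  have hτ : Function.Injective τ := by
    intro α β h
    have := e.symm.injective h
    exact hf.injective (by simpa using this)
  have heq : (fun α i => eval x (pderiv i (f α))) = (eval x).mapMatrix J ∘ τ := by
    funext α i
    change _ = eval x (pderiv i (e (τ α) : MvPolynomial ι k))
    simp [τ]
  rw [heq]
  exact hrow.comp τ hτ

/-! ### Genericity, tested on affine lines. -/

/-- A function on a vector space whose restriction to every affine line is polynomial. -/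
def IsPolynomialOnLines {W : Type*} [AddCommGroup W] [Module ℂ W] (F : W → ℂ) : Prop :=
  ∀ w u : W, ∃ p : Polynomial ℂ, ∀ s : ℂ, F (w + s • u) = p.eval s

namespace IsPolynomialOnLines

variable {W W' : Type*} [AddCommGroup W] [Module ℂ W] [AddCommGroup W'] [Module ℂ W']

theorem const (c : ℂ) : IsPolynomialOnLines (fun _ : W => c) :=
  fun _ _ => ⟨Polynomial.C c, by simp⟩

theorem linear (φ : W →ₗ[ℂ] ℂ) : IsPolynomialOnLines (fun w => φ w) :=
  fun w u => ⟨Polynomial.C (φ w) + Polynomial.X * Polynomial.C (φ u), fun s => by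
    simpa using mul_comm s (φ u)⟩

theorem add {F G : W → ℂ} (hF : IsPolynomialOnLines F) (hG : IsPolynomialOnLines G) :
    IsPolynomialOnLines (fun w => F w + G w) := by
  intro w u
  obtain ⟨p, hp⟩ := hF w u
  obtain ⟨r, hr⟩ := hG w u
  exact ⟨p + r, by simp [hp, hr]⟩

theorem mul {F G : W → ℂ} (hF : IsPolynomialOnLines F) (hG : IsPolynomialOnLines G) :
    IsPolynomialOnLines (fun w => F w * G w) := by
  intro w u
  obtain ⟨p, hp⟩ := hF w u
  obtain ⟨r, hr⟩ := hG w u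
  exact ⟨p * r, by simp [hp, hr]⟩

theorem sum {κ : Type*} (s : Finset κ) {F : κ → W → ℂ} (hF : ∀ i, IsPolynomialOnLines (F i)) :
    IsPolynomialOnLines (fun w => ∑ i ∈ s, F i w) := by
  intro w u
  choose p hp using fun i => hF i w u
  exact ⟨∑ i ∈ s, p i, by simp [hp, Polynomial.eval_finsetSum]⟩

theorem prod {κ : Type*} (s : Finset κ) {F : κ → W → ℂ} (hF : ∀ i, IsPolynomialOnLines (F i)) :
    IsPolynomialOnLines (fun w => ∏ i ∈ s, F i w) := by
  intro w u
  choose p hp using fun i => hF i w u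
  exact ⟨∏ i ∈ s, p i, by simp [hp, Polynomial.eval_prod]⟩

theorem det {κ : Type*} [Fintype κ] [DecidableEq κ] {M : W → Matrix κ κ ℂ}
    (hM : ∀ i j, IsPolynomialOnLines (fun w => M w i j)) :
    IsPolynomialOnLines (fun w => (M w).det) := by
  simp only [Matrix.det_apply']
  exact sum _ fun σ => (const _).mul (prod _ fun i => hM _ _)

theorem eval {σ : Type*} {g : σ → W → ℂ} (hg : ∀ i, IsPolynomialOnLines (g i))
    (p : MvPolynomial σ ℂ) :
    IsPolynomialOnLines (fun w => MvPolynomial.eval (fun i => g i w) p) := by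
  induction p using MvPolynomial.induction_on with
  | C a => simpa using const a
  | add p r hp hr => simpa using hp.add hr
  | mul_X p i hp => simpa using hp.mul (hg i)

theorem comp_linear {F : W' → ℂ} (hF : IsPolynomialOnLines F) (T : W →ₗ[ℂ] W') :
    IsPolynomialOnLines (fun w => F (T w)) := by
  intro w u
  obtain ⟨p, hp⟩ := hF (T w) (T u)
  exact ⟨p, by simp [hp]⟩

/-- On the line through `w₀` and `w₁` both functions become nonzero polynomials in one variable,
which have a common non-root. -/
theorem exists_ne_zero_and_ne_zero {F G : W → ℂ} (hF : IsPolynomialOnLines F)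
    (hG : IsPolynomialOnLines G) {w₀ w₁ : W} (h₀ : F w₀ ≠ 0) (h₁ : G w₁ ≠ 0) :
    ∃ w, F w ≠ 0 ∧ G w ≠ 0 := by
  obtain ⟨p, hp⟩ := hF w₀ (w₁ - w₀)
  obtain ⟨r, hr⟩ := hG w₀ (w₁ - w₀)
  have hp0 : p ≠ 0 := by
    rintro rfl
    exact h₀ (by simpa using hp 0)
  have hr0 : r ≠ 0 := by
    rintro rfl
    exact h₁ (by simpa using hr 1)
  obtain ⟨s, hs⟩ : ∃ s, (p * r).eval s ≠ 0 := by
    by_contra! h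
    exact mul_ne_zero hp0 hr0 (Polynomial.funext (by simpa using h))
  rw [Polynomial.eval_mul] at hs
  exact ⟨w₀ + s • (w₁ - w₀), by rw [hp]; exact left_ne_zero_of_mul hs,
    by rw [hr]; exact right_ne_zero_of_mul hs⟩

end IsPolynomialOnLines

/-- Linear independence of a finite family that depends polynomially on parameters is an open
condition. -/
theorem LinearIndependent.exists_isPolynomialOnLines {W E κ : Type*} [AddCommGroup W] [Module ℂ W]
    [AddCommGroup E] [Module ℂ E] [Fintype κ] {v : W → κ → E} {w₀ : W}
    (h₀ : LinearIndependent ℂ (v w₀))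
    (hv : ∀ (φ : Module.Dual ℂ E) (i : κ), IsPolynomialOnLines (fun w => φ (v w i))) :
    ∃ F : W → ℂ, IsPolynomialOnLines F ∧ F w₀ ≠ 0 ∧
      ∀ w, F w ≠ 0 → LinearIndependent ℂ (v w) := by
  classical
  -- In the coordinates `T` the family at `w₀` is the standard basis, so the determinant used below
  -- is `1` there.
  obtain ⟨T, hT⟩ := (Fintype.linearCombination ℂ (v w₀)).exists_leftInverse_of_injective
    (by rw [LinearMap.ker_eq_bot]; exact h₀.fintypeLinearCombination_injective)
  have hTv : ∀ i, T (v w₀ i) = Pi.single i 1 := by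
    intro i
    have := LinearMap.congr_fun hT (Pi.single i 1)
    simpa using this
  refine ⟨fun w => (Matrix.of fun i j => T (v w i) j).det, ?_, ?_, ?_⟩
  · exact IsPolynomialOnLines.det fun i j => hv (LinearMap.proj j ∘ₗ T) i
  · have : (Matrix.of fun i j => T (v w₀ i) j) = (1 : Matrix κ κ ℂ) := by
      ext i j
      simp [hTv, Matrix.one_apply, Pi.single_apply, eq_comm]
    simp [this]
  · intro w hw
    have hrow := Matrix.linearIndependent_rows_of_det_ne_zero hw
    exact LinearIndependent.of_comp T hrow

section Representation

variable {𝔤 V : Type*} [LieRing 𝔤] [LieAlgebra ℂ 𝔤] [AddCommGroup V] [Module ℂ V]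

/-- Lower semicontinuity of the rank: vectors `ξ i` whose images form a basis of the range at `x₀`
keep independent images on an open set. -/
theorem finrank_range_orbitMap_le_of_ne_zero [FiniteDimensional ℂ 𝔤] [FiniteDimensional ℂ V]
    (ρ : 𝔤 →ₗ⁅ℂ⁆ Module.End ℂ V) (x₀ : V) :
    ∃ F : V → ℂ, IsPolynomialOnLines F ∧ F x₀ ≠ 0 ∧ ∀ x, F x ≠ 0 →
      Module.finrank ℂ (LinearMap.range (orbitMap ρ x₀)) ≤
        Module.finrank ℂ (LinearMap.range (orbitMap ρ x)) := by
  let B := Module.finBasis ℂ (LinearMap.range (orbitMap ρ x₀))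
  choose ξ hξ using fun i => (B i).2
  have h₀ : LinearIndependent ℂ (fun i => orbitMap ρ x₀ (ξ i)) := by
    simp only [hξ]
    exact B.linearIndependent.map' (Submodule.subtype _) (Submodule.ker_subtype _)
  obtain ⟨F, hF, hF₀, hF'⟩ := LinearIndependent.exists_isPolynomialOnLines
    (v := fun x i => orbitMap ρ x (ξ i)) h₀
    (fun φ i => IsPolynomialOnLines.linear (φ ∘ₗ ρ (ξ i)))
  refine ⟨F, hF, hF₀, fun x hx => ?_⟩
  have hli : LinearIndependent ℂ
      (fun i => (⟨orbitMap ρ x (ξ i), _, rfl⟩ : LinearMap.range (orbitMap ρ x))) :=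
    LinearIndependent.of_comp (Submodule.subtype _) (hF' x hx)
  simpa using hli.fintype_card_le_finrank

theorem exists_finrank_range_orbitMap_eq [FiniteDimensional ℂ V]
    (ρ : 𝔤 →ₗ⁅ℂ⁆ Module.End ℂ V) :
    ∃ x, Module.finrank ℂ (LinearMap.range (orbitMap ρ x)) = dimRegularOrbit ρ := by
  have hbdd : BddAbove (Set.range fun x : V =>
      Module.finrank ℂ (LinearMap.range (orbitMap ρ x))) :=
    ⟨Module.finrank ℂ V, by rintro _ ⟨x, rfl⟩; exact Submodule.finrank_le _⟩
  exact Nat.sSup_mem (Set.range_nonempty _) hbdd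

end Representation

/-! ### Left kernels of the canonical blocks. -/

namespace KroneckerBlock

/-- The equations of the left kernel of the pencil of a block, over polynomials. -/
def IsLeftKernel (b : KroneckerBlock) (v : ℕ → Polynomial ℂ) : Prop :=
  ∀ j < b.cols, ∑ i ∈ Finset.range b.rows,
    (Polynomial.C (b.entryA i j) + Polynomial.X * Polynomial.C (b.entryB i j)) * v i = 0

/-- A non-vertical block is upper triangular over `ℂ[X]` with nonzero diagonal entries and has at
least as many columns as rows, so forward substitution applies. -/
theorem IsLeftKernel.eq_zero {b : KroneckerBlock} {v : ℕ → Polynomial ℂ} (h : b.IsLeftKernel v)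
    (hb : b.rowIndex? = none) : ∀ i < b.rows, v i = 0 := by
  intro i
  induction i using Nat.strong_induction_on with
  | _ i ih =>
    intro hi
    have hcol : i < b.cols := by
      cases b <;> simp_all [rows, cols, rowIndex?]; omega
    have h1 := h i hcol
    rw [Finset.sum_eq_single i] at h1
    · refine (mul_eq_zero.1 h1).resolve_left ?_
      cases b with
      | jordan c n =>
        simpa [entryA, entryB, add_comm] using Polynomial.X_add_C_ne_zero c
      | jordanInf n => simp [entryA, entryB]
      | horizontal e => simp [entryA, entryB]
      | vertical n => simp [rowIndex?] at hb
    · intro k hk hki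
      rcases lt_or_gt_of_ne hki with hlt | hgt
      · rw [ih k hlt (Finset.mem_range.1 hk), mul_zero]
      · have h2 : i ≠ k + 1 := by omega
        cases b <;> simp [entryA, entryB, hki, h2]
        simp [rowIndex?] at hb
    · intro h2
      exact absurd (Finset.mem_range.2 hi) h2

/-- Column `j` reads `v j + X * v (j + 1) = 0`, so the last entry determines the rest. Since `v 0 =
(-X) ^ n * v n`, the minimal index bounds degrees from below. -/
theorem IsLeftKernel.eq_neg_X_pow_mul {n : ℕ} {v : ℕ → Polynomial ℂ}
    (h : (vertical n).IsLeftKernel v) :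
    ∀ m ≤ n, v (n - m) = (-Polynomial.X) ^ m * v n := by
  intro m
  induction m with
  | zero => simp
  | succ m ih =>
    intro hm
    have h1 := h (n - (m + 1)) (by simp only [cols]; omega)
    have hne : n - (m + 1) ≠ n - (m + 1) + 1 := by omega
    rw [← Finset.sum_subset (s₁ := {n - (m + 1), n - (m + 1) + 1}), Finset.sum_pair hne] at h1
    · have h2 : n - (m + 1) + 1 = n - m := by omega
      have h3 : v (n - (m + 1)) + Polynomial.X * v (n - m) = 0 := by
        simpa [entryA, entryB, h2, show n - m ≠ n - (m + 1) by omega,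
          show n - (m + 1) ≠ n - m by omega] using h1
      rw [ih (by omega)] at h3
      rw [eq_neg_of_add_eq_zero_left h3]
      ring
    · intro k hk
      simp only [Finset.mem_insert, Finset.mem_singleton] at hk
      simp only [Finset.mem_range, rows]
      omega
    · intro k _ hk
      simp only [Finset.mem_insert, Finset.mem_singleton, not_or] at hk
      simp [entryA, entryB, hk.1, hk.2]

/-- The minimal row index of a block, extended by zero to non-vertical blocks. -/
def rowIndex (b : KroneckerBlock) : ℕ := b.rowIndex?.getD 0

theorem eq_vertical_of_isSome {b : KroneckerBlock} (hb : b.rowIndex?.isSome) :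
    b = vertical b.rowIndex := by
  cases b <;> simp_all [rowIndex?, rowIndex]

theorem rows_eq_rowIndex_add_one {b : KroneckerBlock} (hb : b.rowIndex?.isSome) :
    b.rows = b.rowIndex + 1 := by
  cases b <;> simp_all [rowIndex?, rowIndex, rows]

theorem rowIndex_lt_rows {b : KroneckerBlock} (hb : b.rowIndex?.isSome) : b.rowIndex < b.rows := by
  rw [rows_eq_rowIndex_add_one hb]
  exact Nat.lt_succ_self _

/-- The last row of each vertical block lies outside the range of `A`, which bounds the number of
such blocks by the corank. -/
theorem entryA_rowIndex_eq_zero {b : KroneckerBlock} (hb : b.rowIndex?.isSome) {j : ℕ}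
    (hj : j < b.cols) : b.entryA b.rowIndex j = 0 := by
  cases b with
  | vertical n =>
    change j < n at hj
    change (if n = j then (1 : ℂ) else 0) = 0
    rw [if_neg (by omega)]
  | _ => simp [rowIndex?] at hb

end KroneckerBlock

/-! ### Degrees of left kernel solutions against minimal row indices. -/

theorem PencilType.rowIndices_ofBlocks {N : ℕ} (β : Fin N → KroneckerBlock) :
    (PencilType.ofBlocks (Finset.univ.val.map β)).rowIndices =
      (Finset.univ : Finset {k // (β k).rowIndex?.isSome}).val.map
        fun k : {k // (β k).rowIndex?.isSome} => (β k).rowIndex := by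
  have h1 : ∀ s : Multiset (Fin N), (s.map β).filterMap KroneckerBlock.rowIndex? =
      (s.filter fun k => (β k).rowIndex?.isSome).map fun k => (β k).rowIndex := by
    intro s
    induction s using Multiset.induction_on with
    | empty => simp
    | cons k s ih =>
      rw [Multiset.map_cons]
      cases h : (β k).rowIndex? with
      | none =>
        rw [Multiset.filterMap_cons_none _ _ h, ih,
          Multiset.filter_cons_of_neg _ (by simp [h])]
      | some n =>
        rw [Multiset.filterMap_cons_some _ _ _ h, ih, Multiset.filter_cons_of_pos _ (by simp [h]),
          Multiset.map_cons]
        simp [KroneckerBlock.rowIndex, h]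
  simp only [PencilType.ofBlocks]
  rw [h1, ← Finset.filter_val, ← Finset.univ_val_map_subtype_val, Multiset.map_map]
  rfl

/-- Linearly independent polynomial solutions of the left kernel equation of a pencil are, after
permutation, bounded below in degree by the minimal row indices. If their degrees have the smallest
possible sum, they are the minimal row indices. -/
theorem HasPencilType.rowIndices_eq {U V : Type*} [AddCommGroup U] [Module ℂ U] [AddCommGroup V]
    [Module ℂ V] [FiniteDimensional ℂ V] {A B : U →ₗ[ℂ] V} {t : PencilType}
    (ht : HasPencilType A B t) {q : ℕ} (g : Fin q → V →ₗ[ℂ] Polynomial ℂ) (d : Fin q → ℕ)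
    (hd : ∀ α v, (g α v).natDegree ≤ d α)
    (hker : ∀ α ξ, g α (A ξ) + Polynomial.X * g α (B ξ) = 0)
    (hind : ∀ y : Fin q → ℂ, (∀ v, ∑ α, y α * (g α v).coeff 0 = 0) → y = 0)
    (hrank : Module.finrank ℂ V ≤ q + Module.finrank ℂ (LinearMap.range A))
    (hsum : ∑ α, (d α + 1) = t.kVert) :
    t.rowIndices = Finset.univ.val.map d := by
  classical
  obtain ⟨N, β, bU, bV, hA, hB, rfl⟩ := ht
  rw [PencilType.kVert, PencilType.rowIndices_ofBlocks, Multiset.map_map] at hsum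
  rw [PencilType.rowIndices_ofBlocks]
  have hAb : ∀ k j, A (bU ⟨k, j⟩) = ∑ i, (β k).matA i j • bV ⟨k, i⟩ := by
    intro k j
    rw [← bV.sum_repr (A (bU ⟨k, j⟩))]
    simp only [← LinearMap.toMatrix_apply, hA]
    rw [Fintype.sum_sigma, Finset.sum_eq_single k]
    · simp [Matrix.blockDiagonal'_apply_eq]
    · intro k' _ hk'
      simp [Matrix.blockDiagonal'_apply_ne _ _ _ hk']
    · simp
  have hBb : ∀ k j, B (bU ⟨k, j⟩) = ∑ i, (β k).matB i j • bV ⟨k, i⟩ := by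
    intro k j
    rw [← bV.sum_repr (B (bU ⟨k, j⟩))]
    simp only [← LinearMap.toMatrix_apply, hB]
    rw [Fintype.sum_sigma, Finset.sum_eq_single k]
    · simp [Matrix.blockDiagonal'_apply_eq]
    · intro k' _ hk'
      simp [Matrix.blockDiagonal'_apply_ne _ _ _ hk']
    · simp
  -- Block components of the solutions, padded by zero to match the `ℕ`-indexed `IsLeftKernel`.
  let G : Fin q → Fin N → ℕ → Polynomial ℂ := fun α k i =>
    if h : i < (β k).rows then g α (bV ⟨k, ⟨i, h⟩⟩) else 0
  have hG : ∀ α k (i : Fin (β k).rows), g α (bV ⟨k, i⟩) = G α k i := by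
    intro α k i
    simp [G]
  have hGd : ∀ α k i, (G α k i).natDegree ≤ d α := by
    intro α k i
    by_cases h : i < (β k).rows
    · simpa [G, h] using hd α _
    · simp [G, h]
  have hGker : ∀ α k, (β k).IsLeftKernel (G α k) := by
    intro α k j hj
    have h1 := hker α (bU ⟨k, ⟨j, hj⟩⟩)
    rw [hAb, hBb, map_sum, map_sum, Finset.mul_sum, ← Finset.sum_add_distrib] at h1
    rw [← Fin.sum_univ_eq_sum_range (fun i => (Polynomial.C ((β k).entryA i j) +
      Polynomial.X * Polynomial.C ((β k).entryB i j)) * G α k i), ← h1]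
    refine Finset.sum_congr rfl fun i _ => ?_
    rw [map_smul, map_smul, hG, KroneckerBlock.matA, KroneckerBlock.matB, Matrix.of_apply,
      Matrix.of_apply, Polynomial.smul_eq_C_mul, Polynomial.smul_eq_C_mul]
    ring
  let K := {k // (β k).rowIndex?.isSome}
  have hGv : ∀ α (k : K), ∀ m ≤ (β k).rowIndex, G α k ((β k).rowIndex - m) =
      (-Polynomial.X) ^ m * G α k (β k).rowIndex := by
    intro α k
    have h1 := hGker α k
    rw [KroneckerBlock.eq_vertical_of_isSome k.2] at h1
    exact h1.eq_neg_X_pow_mul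
  -- Constant terms vanish on non-vertical blocks and are multiples of the last entry's on vertical
  -- ones, so a relation among last entries is a relation on all of `V`.
  have hrow : LinearIndependent ℂ (fun α (k : K) => (G α k (β k).rowIndex).coeff 0) := by
    rw [Fintype.linearIndependent_iff]
    intro y hy
    refine congrFun (hind y fun v => ?_)
    let T : V →ₗ[ℂ] ℂ := ∑ α, y α • (Polynomial.lcoeff ℂ 0 ∘ₗ g α)
    have hT : ∀ v, T v = ∑ α, y α * (g α v).coeff 0 := by
      intro v
      simp [T]
    rw [← hT]
    suffices h : T = 0 by rw [h]; rfl
    refine bV.ext fun ⟨k, i⟩ => ?_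
    rw [hT]
    simp only [hG, LinearMap.zero_apply]
    cases hk : (β k).rowIndex? with
    | none =>
      refine Finset.sum_eq_zero fun α _ => ?_
      rw [(hGker α k).eq_zero hk i i.2]
      simp
    | some n =>
      have hk' : (β k).rowIndex?.isSome := by simp [hk]
      have hle : (i : ℕ) ≤ (β k).rowIndex := by
        exact Nat.lt_succ_iff.1 (i.2.trans_eq (KroneckerBlock.rows_eq_rowIndex_add_one hk'))
      obtain ⟨m, hm⟩ := Nat.exists_eq_add_of_le' hle
      have hi' : (i : ℕ) = (β k).rowIndex - m := by omega
      have hm' : m ≤ (β k).rowIndex := by omega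
      simp only [hi', hGv _ ⟨k, hk'⟩ m hm', Polynomial.mul_coeff_zero]
      have := congrFun hy ⟨k, hk'⟩
      simp only [Finset.sum_apply, Pi.smul_apply, smul_eq_mul, Pi.zero_apply] at this
      simp only [mul_left_comm (y _), ← Finset.mul_sum, this, mul_zero]
  have hcardle : q ≤ Fintype.card K := by
    simpa using hrow.fintype_card_le_finrank
  have hcardge : Fintype.card K ≤ q := by
    -- The last-row coordinates map `V` onto `K → ℂ` and kill the range of `A`.
    let T : V →ₗ[ℂ] (K → ℂ) := LinearMap.pi fun k =>
      bV.coord ⟨k, ⟨(β k).rowIndex, KroneckerBlock.rowIndex_lt_rows k.2⟩⟩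
    have hTs : Function.Surjective T := by
      intro z
      refine ⟨∑ k : K, z k • bV ⟨k, ⟨(β k).rowIndex, KroneckerBlock.rowIndex_lt_rows k.2⟩⟩, ?_⟩
      funext k
      simp only [T, LinearMap.pi_apply, map_sum, map_smul, Module.Basis.coord_apply,
        Module.Basis.repr_self, smul_eq_mul]
      rw [Finset.sum_eq_single k]
      · simp
      · intro k' _ hk'
        rw [Finsupp.single_eq_of_ne, mul_zero]
        intro h
        exact hk' (Subtype.ext (congrArg Sigma.fst h).symm)
      · simp
    have hle : LinearMap.range A ≤ LinearMap.ker T := by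
      rw [LinearMap.range_le_ker_iff]
      refine bU.ext fun ⟨k, j⟩ => ?_
      funext k'
      simp only [T, LinearMap.comp_apply, LinearMap.pi_apply, Module.Basis.coord_apply,
        LinearMap.zero_apply, Pi.zero_apply]
      rw [← LinearMap.toMatrix_apply, hA]
      by_cases hkk : (k' : Fin N) = k
      · subst hkk
        rw [Matrix.blockDiagonal'_apply_eq, KroneckerBlock.matA, Matrix.of_apply]
        exact KroneckerBlock.entryA_rowIndex_eq_zero k'.2 j.2
      · exact Matrix.blockDiagonal'_apply_ne _ _ _ hkk
    have h1 := Submodule.finrank_mono hle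
    have h2 := T.finrank_range_add_finrank_ker
    rw [LinearMap.range_eq_top.2 hTs, finrank_top, Module.finrank_fintype_fun_eq_card] at h2
    omega
  obtain ⟨e⟩ : Nonempty (Fin q ≃ K) := by
    rw [← Fintype.card_eq, Fintype.card_fin]
    exact le_antisymm hcardle hcardge
  let M : Matrix (Fin q) (Fin q) ℂ := Matrix.of fun α γ =>
    (G α (e γ) (β (e γ)).rowIndex).coeff 0
  have hM : M.det ≠ 0 := by
    have h1 : LinearIndependent ℂ M.row :=
      hrow.map' (LinearMap.funLeft ℂ ℂ e)
        (LinearMap.ker_eq_bot.2 (LinearMap.funLeft_injective_of_surjective _ _ _ e.surjective))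
    have h2 := Matrix.linearIndependent_rows_iff_isUnit.1 h1
    exact ((Matrix.isUnit_iff_isUnit_det _).1 h2).ne_zero
  -- A nonzero term of the Leibniz expansion pairs each vertical block with a solution whose last
  -- entry there has nonzero constant term.
  obtain ⟨σ, -, hσ⟩ : ∃ σ ∈ (Finset.univ : Finset (Equiv.Perm (Fin q))),
      ((Equiv.Perm.sign σ : ℤ) : ℂ) * ∏ i, M (σ i) i ≠ 0 := by
    rw [Matrix.det_apply'] at hM
    exact Finset.exists_ne_zero_of_sum_ne_zero hM
  have hne : ∀ γ, M (σ γ) γ ≠ 0 := fun γ =>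
    Finset.prod_ne_zero_iff.1 (right_ne_zero_of_mul hσ) γ (Finset.mem_univ _)
  have hdeg : ∀ γ, (β (e γ)).rowIndex ≤ d (σ γ) := by
    intro γ
    -- The entry at index `0`, written as a difference to fit `hGv`, has nonzero coefficient at `X ^
    -- rowIndex`.
    refine le_trans (Polynomial.le_natDegree_of_ne_zero ?_)
      (hGd (σ γ) (e γ) ((β (e γ)).rowIndex - (β (e γ)).rowIndex))
    rw [hGv _ _ _ le_rfl, neg_pow, mul_right_comm, Polynomial.coeff_mul_X_pow', if_pos le_rfl,
      Nat.sub_self, Polynomial.mul_coeff_zero]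
    refine mul_ne_zero ?_ (hne γ)
    rw [Polynomial.coeff_zero_eq_eval_zero]
    simp
  have hsum' : ∑ γ, (β (e γ)).rowIndex = ∑ γ, d (σ γ) := by
    have h1 : ∑ k : K, ((β k).rowIndex + 1) = ∑ γ, ((β (e γ)).rowIndex + 1) :=
      (e.sum_comp fun k : K => (β k).rowIndex + 1).symm
    have h2 : ∑ α, (d α + 1) = ∑ k : K, ((β k).rowIndex + 1) := hsum
    rw [h1, ← Equiv.sum_comp σ, Finset.sum_add_distrib, Finset.sum_add_distrib] at h2
    omega
  have heq : ∀ γ, (β (e γ)).rowIndex = d (σ γ) := fun γ =>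
    (Finset.sum_eq_sum_iff_of_le fun γ _ => hdeg γ).1 hsum' γ (Finset.mem_univ _)
  have h1 : (Finset.univ : Finset K).val.map (fun k : K => (β k).rowIndex) =
      (Finset.univ : Finset (Fin q)).val.map fun γ => (β (e γ)).rowIndex := by
    rw [← Finset.map_univ_equiv e, Finset.map_val, Multiset.map_map]
    rfl
  have h2 : (Finset.univ : Finset (Fin q)).val.map d =
      (Finset.univ : Finset (Fin q)).val.map fun γ => d (σ γ) := by
    conv_lhs => rw [← Finset.map_univ_equiv σ, Finset.map_val, Multiset.map_map]
    rfl
  rw [h1, h2]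
  simp only [heq]

/-! ### Differentials of invariants along a line. -/

theorem MvPolynomial.natDegree_aeval_le {σ k : Type*} [CommRing k] (p : MvPolynomial σ k)
    (ℓ : σ → Polynomial k) (hℓ : ∀ i, (ℓ i).natDegree ≤ 1) :
    (aeval ℓ p).natDegree ≤ p.totalDegree := by
  rw [aeval_def, eval₂_eq]
  refine Polynomial.natDegree_sum_le_of_forall_le _ _ fun m hm => ?_
  refine (Polynomial.natDegree_C_mul_le _ _).trans ((Polynomial.natDegree_prod_le _ _).trans ?_)
  refine le_trans (Finset.sum_le_sum fun i _ => ?_) (le_totalDegree hm)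
  exact Polynomial.natDegree_pow_le.trans (by simpa using Nat.mul_le_mul_left (m i) (hℓ i))

theorem MvPolynomial.totalDegree_pderiv_le {σ k : Type*} [CommRing k] (p : MvPolynomial σ k)
    (i : σ) : (pderiv i p).totalDegree ≤ p.totalDegree - 1 := by
  classical
  rw [p.as_sum, map_sum]
  refine totalDegree_finsetSum_le fun m hm => ?_
  rw [← p.as_sum, pderiv_monomial]
  by_cases hi : m i = 0
  · simp [hi]
  refine (totalDegree_monomial_le _ _).trans ?_
  have h1 := le_totalDegree hm
  have h2 : m = (m - Finsupp.single i 1) + Finsupp.single i 1 :=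
    (tsub_add_cancel_of_le (by simpa [Nat.one_le_iff_ne_zero] using hi)).symm
  rw [h2, Finsupp.sum_add_index' (by simp) (by simp), Finsupp.sum_single_index rfl] at h1
  exact Nat.le_sub_of_add_le h1

section Representation

variable {𝔤 V : Type*} [LieRing 𝔤] [LieAlgebra ℂ 𝔤] [AddCommGroup V] [Module ℂ V]
  {ι : Type*} [Fintype ι]

/-- The differential of a polynomial along the line `x + s a`, as a polynomial in `s`. -/
noncomputable def differentialAlongLine (b : Module.Basis ι ℂ V) (f : MvPolynomial ι ℂ)
    (x a : V) : V →ₗ[ℂ] Polynomial ℂ :=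
  ∑ i, (b.coord i).smulRight (MvPolynomial.aeval
    (fun j => Polynomial.C (b.repr x j) + Polynomial.X * Polynomial.C (b.repr a j))
    (MvPolynomial.pderiv i f))

theorem eval_differentialAlongLine (b : Module.Basis ι ℂ V) (f : MvPolynomial ι ℂ) (x a v : V)
    (s : ℂ) : (differentialAlongLine b f x a v).eval s = differentialAt b f (x + s • a) v := by
  have h : ∀ p : MvPolynomial ι ℂ, (MvPolynomial.aeval (fun j => Polynomial.C (b.repr x j) +
      Polynomial.X * Polynomial.C (b.repr a j)) p).eval s =
      MvPolynomial.eval (fun j => b.repr (x + s • a) j) p := by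
    intro p
    induction p using MvPolynomial.induction_on with
    | C c => simp
    | add p r hp hr => simp only [map_add, Polynomial.eval_add, hp, hr]
    | mul_X p i hp =>
      rw [map_mul, Polynomial.eval_mul, hp, map_mul]
      simp [mul_comm s, -Polynomial.X_mul_C]
  rw [differentialAlongLine, differentialAt, LinearMap.sum_apply, LinearMap.sum_apply,
    Polynomial.eval_finsetSum]
  refine Finset.sum_congr rfl fun i _ => ?_
  rw [LinearMap.smulRight_apply, Polynomial.eval_smul, h, LinearMap.smul_apply, smul_eq_mul,
    smul_eq_mul, mul_comm]

theorem natDegree_differentialAlongLine_le (b : Module.Basis ι ℂ V) (f : MvPolynomial ι ℂ)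
    (x a v : V) : (differentialAlongLine b f x a v).natDegree ≤ f.totalDegree - 1 := by
  rw [differentialAlongLine, LinearMap.sum_apply]
  refine Polynomial.natDegree_sum_le_of_forall_le _ _ fun i _ => ?_
  rw [LinearMap.smulRight_apply]
  refine (Polynomial.natDegree_smul_le _ _).trans
    ((MvPolynomial.natDegree_aeval_le _ _ fun j => ?_).trans
      (MvPolynomial.totalDegree_pderiv_le f i))
  refine Polynomial.natDegree_add_le_of_degree_le (by simp) ?_
  exact (Polynomial.natDegree_mul_C_le _ _).trans Polynomial.natDegree_X_le

/-- Invariance at `x + s a`, with `orbitMap` linear in the point, gives the identity for every value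
of `s`. -/
theorem IsInvariantPolynomial.differentialAlongLine_mem_leftKernel
    {ρ : 𝔤 →ₗ⁅ℂ⁆ Module.End ℂ V} {b : Module.Basis ι ℂ V} {f : MvPolynomial ι ℂ}
    (hf : IsInvariantPolynomial ρ b f) (x a : V) (ξ : 𝔤) :
    differentialAlongLine b f x a (orbitMap ρ x ξ) +
      Polynomial.X * differentialAlongLine b f x a (orbitMap ρ a ξ) = 0 := by
  refine Polynomial.funext fun s => ?_
  have h := LinearMap.congr_fun (hf (x + s • a)) ξ
  have h1 : orbitMap ρ (x + s • a) ξ = orbitMap ρ x ξ + s • orbitMap ρ a ξ := by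
    simp [orbitMap]
  rw [LinearMap.dualMap_apply, h1, map_add, map_smul] at h
  simpa [eval_differentialAlongLine] using h

theorem exists_linearIndependent_differentialAt {κ : Type*} (b : Module.Basis ι ℂ V)
    {f : κ → MvPolynomial ι ℂ} (hf : AlgebraicIndependent ℂ f) :
    ∃ x, LinearIndependent ℂ (fun α => differentialAt b (f α) x) := by
  obtain ⟨z, hz⟩ := hf.exists_linearIndependent_pderiv
  refine ⟨b.equivFun.symm z, ?_⟩
  let T : Module.Dual ℂ V →ₗ[ℂ] (ι → ℂ) := LinearMap.pi fun i => LinearMap.applyₗ (b i)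
  refine LinearIndependent.of_comp T ?_
  suffices heq : T ∘ (fun α => differentialAt b (f α) (b.equivFun.symm z)) =
      fun α i => MvPolynomial.eval z (MvPolynomial.pderiv i (f α)) by
    rw [heq]
    exact hz
  classical
  funext α i
  simp [T, differentialAt, Finsupp.single_apply]

/-- On a dense open set the orbit map has maximal rank and the differentials of algebraically
independent polynomials are linearly independent; such a set meets every non-empty Zariski open
set of pairs. -/
theorem IsZariskiOpen.exists_regular_mem [FiniteDimensional ℂ 𝔤] [FiniteDimensional ℂ V]
    {κ : Type*} [Fintype κ] {O : Set (V × V)} (hO : IsZariskiOpen O) (hne : O.Nonempty)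
    (ρ : 𝔤 →ₗ⁅ℂ⁆ Module.End ℂ V) (b : Module.Basis ι ℂ V)
    {f : κ → MvPolynomial ι ℂ} (hf : AlgebraicIndependent ℂ f) :
    ∃ p ∈ O, dimRegularOrbit ρ ≤ Module.finrank ℂ (LinearMap.range (orbitMap ρ p.1)) ∧
      LinearIndependent ℂ (fun α => differentialAt b (f α) p.1) := by
  obtain ⟨S, rfl⟩ := hO
  obtain ⟨w₀, P, hPS, hP⟩ := hne
  obtain ⟨x₁, hx₁⟩ := exists_finrank_range_orbitMap_eq ρ
  obtain ⟨F, hF, hF₁, hF'⟩ := finrank_range_orbitMap_le_of_ne_zero ρ x₁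
  obtain ⟨x₂, hx₂⟩ := exists_linearIndependent_differentialAt b hf
  obtain ⟨G, hG, hG₂, hG'⟩ := LinearIndependent.exists_isPolynomialOnLines
    (v := fun x α => differentialAt b (f α) x) hx₂ (by
      intro φ α
      simp only [differentialAt, map_sum, map_smul, smul_eq_mul]
      exact IsPolynomialOnLines.sum _ fun i => (IsPolynomialOnLines.eval
        (fun j => IsPolynomialOnLines.linear (b.coord j)) _).mul (IsPolynomialOnLines.const _))
  obtain ⟨x₃, h₃, h₃'⟩ := hF.exists_ne_zero_and_ne_zero hG hF₁ hG₂
  -- The conditions `F` and `G` see only the first component, so the second component of `(x₃, 0)`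
  -- is arbitrary.
  obtain ⟨w, hw, hw'⟩ := IsPolynomialOnLines.exists_ne_zero_and_ne_zero
    (IsPolynomialOnLines.eval (fun φ : Module.Dual ℂ (V × V) => IsPolynomialOnLines.linear φ) P)
    ((hF.mul hG).comp_linear (LinearMap.fst ℂ V V)) (w₁ := (x₃, 0)) hP (mul_ne_zero h₃ h₃')
  exact ⟨w, ⟨P, hPS, hw⟩, hx₁ ▸ hF' _ (left_ne_zero_of_mul hw'), hG' _ (right_ne_zero_of_mul hw')⟩

/-- Constants are algebraic. Positivity makes the truncated subtraction `totalDegree - 1` a true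
one. -/
theorem one_le_totalDegree_of_algebraicIndependent {k σ κ : Type*} [Field k]
    {f : κ → MvPolynomial σ k} (hf : AlgebraicIndependent k f) (α : κ) :
    1 ≤ (f α).totalDegree := by
  by_contra h
  have h0 : (f α).totalDegree = 0 := by omega
  apply hf.transcendental α
  rw [(MvPolynomial.totalDegree_eq_zero_iff_eq_C).1 h0]
  exact isAlgebraic_algebraMap _

end Representation

theorem mainTheorem12 {𝔤 V : Type*} [LieRing 𝔤] [LieAlgebra ℂ 𝔤] [FiniteDimensional ℂ 𝔤]
    [AddCommGroup V] [Module ℂ V] [FiniteDimensional ℂ V]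
    (ρ : 𝔤 →ₗ⁅ℂ⁆ Module.End ℂ V)
    {ι : Type*} [Fintype ι] (b : Module.Basis ι ℂ V)
    (f : Fin (codimRegularOrbit ρ) → MvPolynomial ι ℂ)
    (hinv : ∀ α, IsInvariantPolynomial ρ b (f α))
    (halg : AlgebraicIndependent ℂ f)
    (hdeg : ∑ α, (f α).totalDegree = totalKroneckerVIndex ρ) :
    (∀ α, 1 ≤ (f α).totalDegree) ∧
    minimalRowIndices ρ = Finset.univ.val.map (fun α => (f α).totalDegree - 1) := by
  have hpos := one_le_totalDegree_of_algebraicIndependent halg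
  refine ⟨hpos, ?_⟩
  -- Neither existence nor uniqueness of the generic type is needed: the argument works for
  -- whichever type is chosen, and also for the default.
  by_cases hgen : ∃ t, IsGenericType ρ t
  · have ht : IsGenericType ρ (jordanKroneckerInvariant ρ) := by
      rw [jordanKroneckerInvariant, dif_pos hgen]
      exact hgen.choose_spec
    obtain ⟨O, hO, hne, hOt⟩ := ht
    obtain ⟨⟨x, a⟩, hmem, hrank, hli⟩ := hO.exists_regular_mem hne ρ b halg
    refine (hOt _ hmem).rowIndices_eq (fun α => differentialAlongLine b (f α) x a) _
      (fun α v => natDegree_differentialAlongLine_le b (f α) x a v)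
      (fun α ξ => (hinv α).differentialAlongLine_mem_leftKernel x a ξ) ?_ ?_ ?_
    · intro y hy
      refine funext (Fintype.linearIndependent_iff.1 hli y (LinearMap.ext fun v => ?_))
      simpa [Polynomial.coeff_zero_eq_eval_zero, eval_differentialAlongLine] using hy v
    · have h1 : dimRegularOrbit ρ ≤ Module.finrank ℂ (LinearMap.range (orbitMap ρ x)) := hrank
      change _ ≤ codimRegularOrbit ρ + Module.finrank ℂ (LinearMap.range (orbitMap ρ x))
      rw [codimRegularOrbit]
      omega
    · rw [← totalKroneckerVIndex, ← hdeg]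
      exact Finset.sum_congr rfl fun α _ => Nat.sub_add_cancel (hpos α)
  · -- The default value has `kVert = 0`, which positivity of the degrees allows only if `q = 0`.
    have h0 : jordanKroneckerInvariant ρ = ⟨0, 0, 0⟩ := by
      rw [jordanKroneckerInvariant, dif_neg hgen]
    have hempty : IsEmpty (Fin (codimRegularOrbit ρ)) := by
      refine ⟨fun α => ?_⟩
      have h1 := Finset.single_le_sum (f := fun α => (f α).totalDegree)
        (fun _ _ => Nat.zero_le _) (Finset.mem_univ α)
      rw [hdeg, totalKroneckerVIndex, h0] at h1
      have h2 := hpos α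
      simp [PencilType.kVert] at h1
      omega
    rw [minimalRowIndices, h0]
    simp
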